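/- \textbf{Conventions.} An \emph{equational condition} is a set of identities $s\approx t$ between terms over a set of finitary function symbols. It is a \emph{minor condition} if each side of each of its identities contains exactly one occurrence of a function symbol, and it is \emph{balanced} if in each of its identities the same variables appear on both sides. A \emph{weak equational condition} is a disjunction $\bigvee_{i\in\omega}\Delta_i$ of equational conditions. For a relational structure $\mathfrak A$, the polymorphism clone $\operatorname{Pol}(\mathfrak A)$ consists of all finitary operations on the domain of $\mathfrak A$ that preserve every relation of $\mathfrak A$. It is \emph{idempotent} if all its members satisfy $f(x,\dots,x)=x$, and \emph{finite} if the domain is finite (and non-empty). It \emph{satisfies} an equational condition if the function symbols can be interpreted by members of $\operatorname{Pol}(\mathfrak A)$ of the same arity so that all the identities hold for all evaluations of the variables. The \emph{pseudo-version} $\overline\Sigma$ of a minor condition $\Sigma$ is obtained by replacing each identity $s\approx t$ of $\Sigma$ by $u(s)\approx v(t)$, where $u,v$ are new unary function symbols, a new pair for each identity. A countably infinite structure $\mathfrak A$ is \emph{$\omega$-categorical} if $\operatorname{Aut}(\mathfrak A)$ has only finitely many orbits on $n$-tuples for every $n$. It is \emph{homogeneous} if every embedding into $\mathfrak A$ of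 the substructure of $\mathfrak A$ induced on a finite set extends to an automorphism of $\mathfrak A$. It is a \emph{model-complete core} if every endomorphism of $\mathfrak A$ coincides on every finite set with some automorphism of $\mathfrak A$. It has \emph{small orbit growth} if the number of orbits of $\operatorname{Aut}(\mathfrak A)$ on $n$-tuples is $o(2^{2^n})$ as $n\to\infty$. \textbf{Theorem.} Let $\Sigma$ be a balanced minor condition and let $\bigvee_{i\in\omega}\Delta_i$ be a weak equational condition such that for every $i\in\omega$ there exists a finite idempotent polymorphism clone that satisfies $\Sigma$ and does not satisfy $\Delta_i$. Then there exists a (countably infinite, relational) $\omega$-categorical homogeneous model-complete core $\mathfrak A$ with small orbit growth such that $\operatorname{Pol}(\mathfrak A)$ satisfies $\overline\Sigma$ and does not satisfy $\Delta_i$ for any $i\in\omega$. Moreover, if $\Sigma$ is countable, then $\operatorname{Pol}(\mathfrak A)$ also satisfies the pseudo-version of $\Sigma$ in which the new unary symbols depend only on the terms, that is, there is one new unary symbol $u_t$ for each term $t$, and each identity $s\approx t$ of $\Sigma$ is replaced by $u_s(s)\approx u_t(t)$. (For example, a chain $t_1\approx t_2\approx\dots\approx t_n$ becomes $u_1(t_1)\approx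 u_2(t_2)\approx\dots\approx u_n(t_n)$.) -/

import Mathlib

open FirstOrder FirstOrder.Language Filter Asymptotics

universe u v u' v' w

/-! ## Equational conditions -/

/-- An equational condition over the function symbols of `L`: a system of identities `s ≈ t`
(represented by pairs `(s, t)`) between terms in countably many variables. -/
abbrev EquationalCondition (L : FirstOrder.Language.{u, v}) : Type u := Set (L.Term ℕ × L.Term ℕ)

/-- A term with exactly one occurrence of a function symbol, i.e. `f(x₁, …, xₙ)` with variables
`x₁, …, xₙ` that need not be distinct. -/
def IsMinorTerm {L : FirstOrder.Language.{u, v}} (t : L.Term ℕ) : Prop :=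
  ∃ (n : ℕ) (f : L.Functions n) (x : Fin n → ℕ), t = Term.func f (fun i => Term.var (x i))

namespace EquationalCondition

/-- Both sides of every identity contain exactly one occurrence of a function symbol. -/
def IsMinor {L : FirstOrder.Language.{u, v}} (S : EquationalCondition L) : Prop :=
  ∀ e ∈ S, IsMinorTerm e.1 ∧ IsMinorTerm e.2

/-- In every identity the same variables appear on both sides. -/
def IsBalanced {L : FirstOrder.Language.{u, v}} (S : EquationalCondition L) : Prop :=
  ∀ e ∈ S, e.1.varFinset = e.2.varFinset

end EquationalCondition

/-- The function symbols of the language with one unary symbol for each element of `U`. -/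
inductive UnarySymbols (U : Type w) : ℕ → Type w
  | symb (x : U) : UnarySymbols U 1

/-- The language with one unary function symbol for each element of `U` and no other symbols. -/
def unaryLanguage (U : Type w) : FirstOrder.Language.{w, 0} :=
  ⟨UnarySymbols U, fun _ => Empty⟩

/-- The term `u(t)` for a new unary function symbol `u`. -/
def pseudoTerm {L : FirstOrder.Language.{u, v}} {U : Type w} (x : U) (t : L.Term ℕ) :
    (L.sum (unaryLanguage U)).Term ℕ :=
  Term.func (L := L.sum (unaryLanguage U)) (l := 1) (Sum.inr (UnarySymbols.symb x))
    (fun _ => (LHom.sumInl : L →ᴸ L.sum (unaryLanguage U)).onTerm t)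

namespace EquationalCondition

/-- The pseudo-version of `S`: every identity `s ≈ t` is replaced by `u(s) ≈ v(t)`, where `u` and
`v` are new unary function symbols, a new pair for every identity. -/
def pseudo {L : FirstOrder.Language.{u, v}} (S : EquationalCondition L) :
    EquationalCondition (L.sum (unaryLanguage (S × Bool))) :=
  Set.range fun e : S => (pseudoTerm (e, false) e.1.1, pseudoTerm (e, true) e.1.2)

/-- The form of the pseudo-version in which the new unary symbol depends only on the term in front
of which it is written: every identity `s ≈ t` is replaced by `u_s(s) ≈ u_t(t)`. For instance, a
chain `t₁ ≈ t₂ ≈ … ≈ tₙ` becomes `u₁(t₁) ≈ u₂(t₂) ≈ … ≈ uₙ(tₙ)`. -/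
def termPseudo {L : FirstOrder.Language.{u, v}} (S : EquationalCondition L) :
    EquationalCondition (L.sum (unaryLanguage (L.Term ℕ))) :=
  (fun e => (pseudoTerm e.1 e.1, pseudoTerm e.2 e.2)) '' S

end EquationalCondition

/-! ## Polymorphisms -/

/-- The `m`-ary operation `f` on `A` is a polymorphism of the relational structure `A`: every
relation of `A` is invariant under `f`. -/
def IsPolymorphism (L : FirstOrder.Language.{u, v}) {A : Type w} [L.Structure A] {m : ℕ}
    (f : (Fin m → A) → A) : Prop :=
  ∀ (n : ℕ) (R : L.Relations n) (r : Fin m → Fin n → A),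
    (∀ i, Structure.RelMap R (r i)) → Structure.RelMap R (fun j => f (fun i => r i j))

/-- The polymorphism clone of the structure `A` satisfies the equational condition `S`: the function
symbols can be interpreted as polymorphisms of `A` of the same arity so that every identity in `S`
holds for all evaluations of the variables. -/
def PolSatisfies (L : FirstOrder.Language.{u, v}) (A : Type w) [L.Structure A] {L' : FirstOrder.Language.{u', v'}}
    (S : EquationalCondition L') : Prop :=
  ∃ I : L'.Structure A,
    (∀ (m : ℕ) (f : L'.Functions m), IsPolymorphism L (@Structure.funMap L' A I m f)) ∧
    ∀ e ∈ S, ∀ x : ℕ → A, @Term.realize L' A I ℕ x e.1 = @Term.realize L' A I ℕ x e.2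

/-- All polymorphisms of `A` are idempotent. -/
def PolIsIdempotent (L : FirstOrder.Language.{u, v}) (A : Type w) [L.Structure A] : Prop :=
  ∀ (m : ℕ) (f : (Fin m → A) → A), IsPolymorphism L f → ∀ a : A, f (fun _ => a) = a

/-- Some finite idempotent polymorphism clone satisfies `S` and does not satisfy `D`. -/
def ExistsFiniteIdempotentSeparation {L : FirstOrder.Language.{u, v}} {L' : FirstOrder.Language.{u', v'}}
    (S : EquationalCondition L) (D : EquationalCondition L') : Prop :=
  ∃ (K : FirstOrder.Language.{0, 0}) (A : Type) (_ : K.Structure A),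
    K.IsRelational ∧ Finite A ∧ Nonempty A ∧ PolIsIdempotent K A ∧
      PolSatisfies K A S ∧ ¬ PolSatisfies K A D

/-! ## Orbits, countable categoricity, model-complete cores -/

/-- Two `n`-tuples are equivalent if some automorphism of `A` maps one to the other. -/
def orbitSetoid (L : FirstOrder.Language.{u, v}) (A : Type w) [L.Structure A] (n : ℕ) :
    Setoid (Fin n → A) where
  r x y := ∃ α : A ≃[L] A, ∀ i, α (x i) = y i
  iseqv :=
    { refl := fun _ => ⟨FirstOrder.Language.Equiv.refl L A, fun _ => rfl⟩
      symm := by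
        rintro x y ⟨α, h⟩
        exact ⟨α.symm, fun i => by rw [← h i]; exact α.symm_apply_apply (x i)⟩
      trans := by
        rintro x y z ⟨α, h⟩ ⟨β, k⟩
        exact ⟨β.comp α, fun i => by rw [← k i, ← h i]; rfl⟩ }

/-- The `n`-orbits of the automorphism group of `A`. -/
def Orbits (L : FirstOrder.Language.{u, v}) (A : Type w) [L.Structure A] (n : ℕ) : Type w :=
  Quotient (orbitSetoid L A n)

/-- `A` is a countably infinite structure whose automorphism group is oligomorphic. -/
def IsOmegaCategorical (L : FirstOrder.Language.{u, v}) (A : Type w) [L.Structure A] : Prop :=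
  Countable A ∧ Infinite A ∧ ∀ n : ℕ, Finite (Orbits L A n)

/-- On every finite set, every endomorphism of `A` coincides with some automorphism of `A`. -/
def IsModelCompleteCore (L : FirstOrder.Language.{u, v}) (A : Type w) [L.Structure A] : Prop :=
  ∀ (e : A →[L] A) (F : Finset A), ∃ α : A ≃[L] A, ∀ x ∈ F, e x = α x

/-- The number of `n`-orbits grows more slowly than `2 ^ 2 ^ n`. -/
def HasSmallOrbitGrowth (L : FirstOrder.Language.{u, v}) (A : Type w) [L.Structure A] : Prop :=
  (fun n : ℕ => (Nat.card (Orbits L A n) : ℝ)) =o[atTop] (fun n : ℕ => (2 : ℝ) ^ 2 ^ n)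

/-! Let `B k` be a finite idempotent structure whose clone satisfies `S` but not `D k`. On a
countable set, take a generic colouring of the `n k`-element subsets by elements of `B k`, for all
`k` at once. The relations of the structure are disequality and the pullbacks to colours of all
invariant relations of `B k`.

Failure of `D k`: since equality of colours is such a relation, every polymorphism acts on
`k`-colours, and the action is by polymorphisms of `B k`. A solution of `D k` would therefore
descend to `B k` (`IsGeneric.polSatisfies_of_polSatisfies`).

Satisfaction of pseudo-`S`: genericity lifts each operation `f` of the `B k` to an injection of a
power of the set whose action on colours is `f`. In a balanced identity both sides become injective
functions of the same variables, and they induce the same colouring because the identity holds in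
every `B k`. Gluing copies of the colouring along these functions and embedding the result yields
the outer unary maps (`IsGeneric.exists_equalizing`). Countably many terms can be glued at once,
hence the version with one symbol per term.

Model theory: by idempotence each single colour is an invariant relation, so a relation-preserving
map on a finite set preserves colours and extends to an automorphism by back-and-forth. An orbit is
thus determined by equalities and colours, and letting `n k` grow fast compared with the size of `B
k` keeps orbit growth small. -/

/-! ## Colourings of finite sets -/

section Colourings

/-- A colouring of the finite subsets of `C` for every index `k`, with colours in `B k`. -/
abbrev Colouring (B : ℕ → Type) (C : Type*) := ∀ k, Finset C → B k

variable {B : ℕ → Type} {C : Type*} {C' : Type*} [DecidableEq C] [DecidableEq C']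

/-- An injection which preserves the `k`-colours of all sets of size `n k`. -/
structure IsStrong (n : ℕ → ℕ) (c : Colouring B C) (c' : Colouring B C') (f : C → C') : Prop where
  injective : Function.Injective f
  colour : ∀ k X, X.card = n k → c' k (X.image f) = c k X

/-- The set of pairs `G` is the graph of an injective partial map which preserves colours. -/
structure IsPartialIso (n : ℕ → ℕ) (c : Colouring B C) (c' : Colouring B C')
    (G : Set (C × C')) : Prop where
  injOn_fst : Set.InjOn Prod.fst G
  injOn_snd : Set.InjOn Prod.snd G
  colour : ∀ k, ∀ Q : Finset (C × C'), ↑Q ⊆ G → Q.card = n k →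
    c k (Q.image Prod.fst) = c' k (Q.image Prod.snd)

/-- Every assignment of colours to the finite sets containing a new element is realized by some
element. -/
def IsGeneric (n : ℕ → ℕ) (c : Colouring B C) : Prop :=
  ∀ (F : Finset C) (h : Colouring B C), ∃ a ∉ F, ∀ k, ∀ Z ⊆ F, Z.card + 1 = n k →
    c k (insert a Z) = h k Z

variable {n : ℕ → ℕ} {c : Colouring B C} {c' : Colouring B C'}

theorem exists_isGeneric [∀ k, Nonempty (B k)] [∀ k, Countable (B k)] (hn : ∀ k, k < n k) :
    ∃ c : Colouring B ℕ, IsGeneric n c := by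
  choose dec hdec using fun k => exists_surjective_nat (B k)
  obtain ⟨e⟩ : Nonempty (ℕ ≃ ((ℕ × Finset ℕ) →₀ ℕ) × ℕ) := nonempty_equiv_of_countable
  -- Each natural number encodes a finitely supported table together with a padding number. The
  -- colour of a set is read from the table of its maximum, at the rest of the set.
  refine ⟨fun k W => dec k ((e (W.sup id)).1 (k, W.erase (W.sup id))), fun F h => ?_⟩
  choose g hg using fun k Z => hdec k (h k Z)
  let s : Finset (ℕ × Finset ℕ) := Finset.range (F.card + 1) ×ˢ F.powerset
  let φ : (ℕ × Finset ℕ) →₀ ℕ := Finsupp.indicator s fun p _ => g p.1 p.2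
  -- The padding makes infinitely many numbers carry the table `φ`, so one of them exceeds all of
  -- `F`.
  have hinj : Function.Injective fun N => e.symm (φ, N) := fun N M h => by simpa using h
  obtain ⟨a, ⟨N, rfl⟩, ha⟩ := (Set.infinite_range_of_injective hinj).exists_gt (F.sup id)
  set a := (fun N => e.symm (φ, N)) N with ha'
  have hlt : ∀ x ∈ F, x < a := fun x hx => lt_of_le_of_lt (Finset.le_sup (f := id) hx) ha
  refine ⟨a, fun haF => lt_irrefl _ (hlt a haF), fun k Z hZ hcard => ?_⟩
  have hmax : (insert a Z).sup id = a := by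
    rw [Finset.sup_insert]
    exact sup_eq_left.2 (Finset.sup_le fun x hx => (hlt x (hZ hx)).le)
  have haZ : a ∉ Z := fun h => lt_irrefl _ (hlt a (hZ h))
  -- Because `k < n k`, only indices `k ≤ F.card` impose a requirement, so a finite table suffices.
  have hkey : (k, Z) ∈ s := by
    have := Finset.card_le_card hZ
    have := hn k
    simp only [s, Finset.mem_product, Finset.mem_range, Finset.mem_powerset]
    exact ⟨by omega, hZ⟩
  simp only [hmax, Finset.erase_insert haZ]
  rw [← hg k Z]
  congr 1
  simp [ha', φ, Finsupp.indicator_of_mem hkey]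

theorem IsPartialIso.swap {G : Set (C × C')} (hG : IsPartialIso n c c' G) :
    IsPartialIso n c' c (Prod.swap ⁻¹' G) where
  injOn_fst p hp q hq h := Prod.swap_injective (hG.injOn_snd hp hq h)
  injOn_snd p hp q hq h := Prod.swap_injective (hG.injOn_fst hp hq h)
  colour k Q hQ hcard := by
    have := hG.colour k (Q.image Prod.swap) (by
      rw [Finset.coe_image]; rintro _ ⟨p, hp, rfl⟩; exact hQ hp)
      (by rw [Finset.card_image_of_injective _ Prod.swap_injective, hcard])
    simpa [Finset.image_image, Function.comp_def] using this.symm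

theorem IsPartialIso.iUnion {G : ℕ → Set (C × C')} (hmono : Monotone G)
    (hG : ∀ i, IsPartialIso n c c' (G i)) : IsPartialIso n c c' (⋃ i, G i) := by
  have key : ∀ Q : Finset (C × C'), ↑Q ⊆ ⋃ i, G i → ∃ i, ↑Q ⊆ G i := fun Q hQ =>
    Directed.exists_mem_subset_of_finset_subset_biUnion hmono.directed_le hQ
  have pair : ∀ p ∈ ⋃ i, G i, ∀ q ∈ ⋃ i, G i, ∃ i, p ∈ G i ∧ q ∈ G i := by
    intro p hp q hq
    obtain ⟨i, hi⟩ := key {p, q} (by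
      intro r hr
      rcases (by simpa using hr : r = p ∨ r = q) with rfl | rfl <;> assumption)
    exact ⟨i, hi (by simp), hi (by simp)⟩
  refine ⟨fun p hp q hq h => ?_, fun p hp q hq h => ?_, fun k Q hQ hcard => ?_⟩
  · obtain ⟨i, h₁, h₂⟩ := pair p hp q hq
    exact (hG i).injOn_fst h₁ h₂ h
  · obtain ⟨i, h₁, h₂⟩ := pair p hp q hq
    exact (hG i).injOn_snd h₁ h₂ h
  · obtain ⟨i, hi⟩ := key Q hQ
    exact (hG i).colour k Q hi hcard

/-- Only the target needs to be generic: its new point `b` is asked to give the sets containing it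
the colours that `a` gives to their preimages. -/
theorem IsPartialIso.exists_extension (hc' : IsGeneric n c') {P : Finset (C × C')}
    (hP : IsPartialIso n c c' (P : Set (C × C'))) (a : C) :
    ∃ P' : Finset (C × C'), P ⊆ P' ∧ IsPartialIso n c c' (P' : Set (C × C')) ∧
      ∃ b, (a, b) ∈ P' := by
  by_cases ha : ∃ b, (a, b) ∈ P
  · exact ⟨P, subset_rfl, hP, ha⟩
  push Not at ha
  obtain ⟨b, hb, hcol⟩ := hc' (P.image Prod.snd)
    fun k (Z : Finset C') => c k (insert a ((P.filter fun p : C × C' => p.2 ∈ Z).image Prod.fst))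
  have hbP : ∀ x, (x, b) ∉ P := fun x hx => hb (Finset.mem_image_of_mem Prod.snd hx)
  refine ⟨insert (a, b) P, Finset.subset_insert _ _, ⟨?_, ?_, ?_⟩, b, Finset.mem_insert_self _ _⟩
  · rw [Finset.coe_insert, Set.injOn_insert (by simpa using ha b)]
    refine ⟨hP.injOn_fst, ?_⟩
    rintro ⟨⟨x, y⟩, hp, rfl⟩
    exact ha y hp
  · rw [Finset.coe_insert, Set.injOn_insert (by simpa using ha b)]
    refine ⟨hP.injOn_snd, ?_⟩
    rintro ⟨⟨x, y⟩, hp, rfl⟩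
    exact hbP x hp
  · intro k Q hQ hcard
    have hQ' : Q ⊆ insert (a, b) P := by exact_mod_cast hQ
    by_cases hab : (a, b) ∈ Q
    · set Q' := Q.erase (a, b) with hQ'_def
      have hsub : Q' ⊆ P := by
        intro p hp
        rw [hQ'_def, Finset.mem_erase] at hp
        exact (Finset.mem_insert.1 (hQ' hp.2)).resolve_left hp.1
      have hins : Q = insert (a, b) Q' := (Finset.insert_erase hab).symm
      have hfilter : (P.filter fun p => p.2 ∈ Q'.image Prod.snd) = Q' := by
        ext p
        simp only [Finset.mem_filter, Finset.mem_image]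
        constructor
        · rintro ⟨hp, q, hq, hqp⟩
          rwa [← hP.injOn_snd (hsub hq) hp hqp]
        · exact fun hp => ⟨hsub hp, p, hp, rfl⟩
      have hcard' : (Q'.image Prod.snd).card + 1 = n k := by
        rw [Finset.card_image_of_injOn (hP.injOn_snd.mono (by exact_mod_cast hsub)), ← hcard,
          hQ'_def, Finset.card_erase_add_one hab]
      have := hcol k (Q'.image Prod.snd) (Finset.image_subset_image hsub) hcard'
      rw [hins, Finset.image_insert, Finset.image_insert, this, hfilter]
    · refine hP.colour k Q (fun p hp => ?_) hcard
      rcases Finset.mem_insert.1 (hQ' hp) with rfl | h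
      · exact absurd hp hab
      · exact h

theorem IsPartialIso.exists_isStrong {G : Set (C × C')} (hG : IsPartialIso n c c' G)
    (htot : ∀ a, ∃ b, (a, b) ∈ G) :
    ∃ f : C → C', IsStrong n c c' f ∧ ∀ a, (a, f a) ∈ G := by
  choose f hf using htot
  refine ⟨f, ⟨fun a b hab => ?_, fun k X hX => ?_⟩, hf⟩
  · exact congrArg Prod.fst (hG.injOn_snd (hf a) (hf b) hab)
  · have := hG.colour k (X.image fun a => (a, f a))
      (by rw [Finset.coe_image]; rintro _ ⟨a, -, rfl⟩; exact hf a)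
      (by rw [Finset.card_image_of_injective _ fun a b h => congrArg Prod.fst h, hX])
    simpa [Finset.image_image, Function.comp_def] using this.symm

/-- Each requirement is cofinal among finite partial isomorphisms, so an increasing sequence meets
all of them. This serves both the one-sided embedding and the back-and-forth argument. -/
theorem exists_limit_isPartialIso {ι : Type*} [Countable ι] (𝒟 : ι → Finset (C × C') → Prop)
    (h𝒟 : ∀ i (P : Finset (C × C')), IsPartialIso n c c' (P : Set (C × C')) →
      ∃ P' : Finset (C × C'), P ⊆ P' ∧ IsPartialIso n c c' (P' : Set (C × C')) ∧ 𝒟 i P')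
    (P₀ : Finset (C × C')) (hP₀ : IsPartialIso n c c' (P₀ : Set (C × C'))) :
    ∃ G : Set (C × C'), ↑P₀ ⊆ G ∧ IsPartialIso n c c' G ∧
      ∀ i, ∃ P : Finset (C × C'), ↑P ⊆ G ∧ 𝒟 i P := by
  have := Encodable.ofCountable ι
  let T := {P : Finset (C × C') // IsPartialIso n c c' (P : Set (C × C'))}
  let D : ι → Order.Cofinal T := fun i => ⟨{P | 𝒟 i P.1}, fun P => by
    obtain ⟨P', h, hP', hi⟩ := h𝒟 i P.1 P.2
    exact ⟨⟨P', hP'⟩, hi, h⟩⟩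
  let σ := Order.sequenceOfCofinals (⟨P₀, hP₀⟩ : T) D
  have hσ : Monotone σ := Order.sequenceOfCofinals.monotone _ _
  refine ⟨⋃ j, ((σ j).1 : Set (C × C')), Set.subset_iUnion (fun j => ((σ j).1 : Set (C × C'))) 0,
    .iUnion (fun i j hij => Finset.coe_subset.2 (hσ hij)) fun j => (σ j).2, fun i => ?_⟩
  exact ⟨(σ (Encodable.encode i + 1)).1, Set.subset_iUnion (fun j => ((σ j).1 : Set (C × C'))) _,
    Order.sequenceOfCofinals.encode_mem (⟨P₀, hP₀⟩ : T) D i⟩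

theorem IsGeneric.exists_isStrong [Countable C] (hn : ∀ k, k < n k) (hc' : IsGeneric n c')
    (c : Colouring B C) : ∃ f : C → C', IsStrong n c c' f := by
  obtain ⟨G, -, hG, htot⟩ := exists_limit_isPartialIso (n := n) (c := c) (c' := c')
    (fun a P => ∃ b, (a, b) ∈ P) (fun a P hP => hP.exists_extension hc' a) ∅
    -- The empty map is a partial isomorphism since `n k` is positive: the empty set carries no
    -- relevant colour.
    ⟨by simp, by simp, fun k Q hQ hcard => by
      obtain rfl : Q = ∅ := by simpa using hQ
      exact absurd (hn k) (by simp [← hcard])⟩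
  obtain ⟨f, hf, -⟩ := hG.exists_isStrong fun a => by
    obtain ⟨P, hP, b, hb⟩ := htot a
    exact ⟨b, hP hb⟩
  exact ⟨f, hf⟩

theorem IsGeneric.exists_equiv [Countable C] [Countable C'] (hc : IsGeneric n c)
    (hc' : IsGeneric n c') (P : Finset (C × C')) (hP : IsPartialIso n c c' (P : Set (C × C'))) :
    ∃ g : C ≃ C', IsStrong n c c' g ∧ ∀ p ∈ P, g p.1 = p.2 := by
  obtain ⟨G, hPG, hG, htot⟩ := exists_limit_isPartialIso (n := n) (c := c) (c' := c')
    (ι := C ⊕ C') (fun i P => Sum.elim (fun a => ∃ b, (a, b) ∈ P) (fun b => ∃ a, (a, b) ∈ P) i)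
    (by
      rintro (a | b) P hP
      · exact hP.exists_extension hc' a
      · have hswap : IsPartialIso n c' c (P.image Prod.swap : Set (C' × C)) := by
          simpa [Set.image_swap_eq_preimage_swap] using hP.swap
        obtain ⟨P', hsub, hP', a, ha⟩ :=
          IsPartialIso.exists_extension hc (P := P.image Prod.swap) (by simpa using hswap) b
        refine ⟨P'.image Prod.swap, fun p hp => ?_, ?_, a, ?_⟩
        · exact Finset.mem_image.2 ⟨p.swap, hsub (Finset.mem_image_of_mem _ hp), p.swap_swap⟩
        · simpa [Set.image_swap_eq_preimage_swap] using hP'.swap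
        · exact Finset.mem_image.2 ⟨_, ha, rfl⟩) P hP
  obtain ⟨f, hf, hfG⟩ := hG.exists_isStrong fun a => by
    obtain ⟨P, hP, b, hb⟩ := htot (Sum.inl a)
    exact ⟨b, hP hb⟩
  have hsurj : Function.Surjective f := fun b => by
    obtain ⟨P, hP, a, ha⟩ := htot (Sum.inr b)
    exact ⟨a, congrArg Prod.snd (hG.injOn_fst (hfG a) (hP ha) rfl)⟩
  refine ⟨Equiv.ofBijective f ⟨hf.injective, hsurj⟩, hf, fun p hp => ?_⟩
  exact congrArg Prod.snd (hG.injOn_fst (hfG p.1) (hPG hp) rfl)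

theorem IsGeneric.exists_card_eq (hn : ∀ k, k < n k) [Infinite C] (hc : IsGeneric n c) (k : ℕ)
    (b : B k) : ∃ X : Finset C, X.card = n k ∧ c k X = b := by
  have : ∀ k, Nonempty (B k) := fun k => ⟨c k ∅⟩
  classical
  obtain ⟨Z, hZ⟩ := Infinite.exists_subset_card_eq C (n k - 1)
  obtain ⟨a, ha, hcol⟩ := hc Z fun l _ => if h : k = l then h ▸ b else Classical.arbitrary _
  have hcard : Z.card + 1 = n k := by have := hn k; omega
  exact ⟨insert a Z, by rw [Finset.card_insert_of_notMem ha, hcard],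
    by simpa using hcol k Z subset_rfl hcard⟩

/-- Countably many injections of a countable set which induce the same colouring can be equalized by
strong maps into a generic colouring. -/
theorem IsGeneric.exists_equalizing {ι D : Type*} [Countable ι] [Countable D] [DecidableEq D]
    [Countable C] (hn : ∀ k, k < n k) (hc : IsGeneric n c) (t : ι → D → C)
    (ht : ∀ i, Function.Injective (t i))
    (hcol : ∀ i j k (X : Finset D), X.card = n k → c k (X.image (t i)) = c k (X.image (t j))) :
    ∃ u : ι → C → C, (∀ i, IsStrong n c c (u i)) ∧ ∀ i j d, u i (t i d) = u j (t j d) := by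
  classical
  -- Copies of `C` indexed by `ι` are glued along the images of `D`; `v i` is the inclusion of the
  -- `i`-th copy. Points `(i, a)` with `a` in the range of `t i` are superfluous but harmless.
  let v : ι → C → D ⊕ (ι × C) := fun i a =>
    if h : ∃ d, t i d = a then Sum.inl h.choose else Sum.inr (i, a)
  have hvt : ∀ i d, v i (t i d) = Sum.inl d := fun i d => by
    have h : ∃ d', t i d' = t i d := ⟨d, rfl⟩
    simp only [v, dif_pos h]
    rw [ht i h.choose_spec]
  have hv_inl : ∀ i a d, v i a = Sum.inl d → t i d = a := fun i a d h => by
    by_cases h' : ∃ d, t i d = a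
    · simp only [v, dif_pos h', Sum.inl.injEq] at h
      rw [← h, h'.choose_spec]
    · simp [v, dif_neg h'] at h
  have hv_inr : ∀ i a j b, v i a = Sum.inr (j, b) → i = j ∧ a = b := fun i a j b h => by
    by_cases h' : ∃ d, t i d = a
    · simp [v, dif_pos h'] at h
    · simpa [v, dif_neg h'] using h
  have hvinj : ∀ i, Function.Injective (v i) := fun i a b hab => by
    rcases hb : v i b with d | ⟨j, x⟩
    · rw [← hv_inl i b d hb, hv_inl i a d (hab.trans hb)]
    · rw [(hv_inr i b j x hb).2, (hv_inr i a j x (hab.trans hb)).2]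
  let c₀ : Colouring B (D ⊕ (ι × C)) := fun k Z =>
    if h : ∃ (i : ι) (Y : Finset C), Y.image (v i) = Z then c k h.choose_spec.choose else c k ∅
  -- A set lying in two different copies lies in the common part `D`, where `hcol` makes the two
  -- colours agree.
  have hwell : ∀ k i j (Y Y' : Finset C), Y.card = n k → Y.image (v i) = Y'.image (v j) →
      c k Y = c k Y' := by
    intro k i j Y Y' hY hYY
    by_cases hij : i = j
    · subst hij
      rw [Finset.image_injective (hvinj i) hYY]
    have hex : ∀ a ∈ Y, ∃ d, t i d = a := fun a ha => by
      obtain ⟨b, -, hb⟩ := Finset.mem_image.1 (hYY ▸ Finset.mem_image_of_mem (v i) ha)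
      rcases hd : v i a with d | ⟨l, x⟩
      · exact ⟨d, hv_inl i a d hd⟩
      · exact absurd ((hv_inr i a l x hd).1.trans (hv_inr j b l x (hb.trans hd)).1.symm) hij
    obtain ⟨X, rfl⟩ : ∃ X : Finset D, X.image (t i) = Y := by
      obtain ⟨X, -, hX⟩ := Finset.subset_set_image_iff.1
        (show (Y : Set C) ⊆ t i '' Set.univ from fun a ha => by simpa using hex a ha)
      exact ⟨X, hX⟩
    have hX : X.card = n k := by rwa [Finset.card_image_of_injective _ (ht i)] at hY
    have hY' : X.image (t j) = Y' := by
      apply Finset.image_injective (hvinj j)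
      rw [← hYY, Finset.image_image, Finset.image_image]
      exact Finset.image_congr fun d _ => by simp [hvt]
    rw [← hY', hcol i j k X hX]
  have hc₀ : ∀ i, IsStrong n c c₀ (v i) := fun i => ⟨hvinj i, fun k Y hY => by
    have h : ∃ (j : ι) (Y' : Finset C), Y'.image (v j) = Y.image (v i) := ⟨i, Y, rfl⟩
    simp only [c₀, dif_pos h]
    exact (hwell k i h.choose Y _ hY h.choose_spec.choose_spec.symm).symm⟩
  obtain ⟨f, hf⟩ := hc.exists_isStrong hn c₀
  refine ⟨fun i a => f (v i a), fun i => ⟨hf.injective.comp (hvinj i), fun k X hX => ?_⟩,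
    fun i j d => by simp only [hvt]⟩
  rw [← (hc₀ i).colour k X hX, ← hf.colour k (X.image (v i))
    (by rw [Finset.card_image_of_injective _ (hvinj i), hX]), Finset.image_image]
  rfl

end Colourings

/-! ## Growth estimates -/

section Growth

/-- By the recurrence for central binomial coefficients, the induction step reduces to `(2m+1)(2m+3)
≤ 4(m+1)²`. -/
theorem centralBinom_sq_mul_le (m : ℕ) : m.centralBinom ^ 2 * (2 * m + 1) ≤ 16 ^ m := by
  induction m with
  | zero => simp
  | succ m ih =>
    have h := Nat.succ_mul_centralBinom_succ m
    have key : (m + 1) ^ 2 * ((m + 1).centralBinom ^ 2 * (2 * (m + 1) + 1))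
        ≤ (m + 1) ^ 2 * 16 ^ (m + 1) := by
      calc (m + 1) ^ 2 * ((m + 1).centralBinom ^ 2 * (2 * (m + 1) + 1))
          = ((m + 1) * (m + 1).centralBinom) ^ 2 * (2 * m + 3) := by ring
        _ = (m.centralBinom ^ 2 * (2 * m + 1)) * (4 * ((2 * m + 1) * (2 * m + 3))) := by
            rw [h]; ring
        _ ≤ 16 ^ m * (4 * (4 * (m + 1) ^ 2)) := Nat.mul_le_mul ih (by nlinarith)
        _ = (m + 1) ^ 2 * 16 ^ (m + 1) := by ring
    exact Nat.le_of_mul_le_mul_left key (by positivity)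

theorem mul_choose_le_two_pow {M r : ℕ} (hr : M ^ 2 ≤ r) (N : ℕ) : M * N.choose r ≤ 2 ^ N := by
  rcases lt_or_ge N r with h | h
  · simp [Nat.choose_eq_zero_of_lt h]
  have key : ∀ m, M ^ 2 ≤ 2 * m + 1 → M * m.centralBinom ≤ 4 ^ m := fun m hm => by
    refine (Nat.pow_le_pow_iff_left two_ne_zero).1 ?_
    calc (M * m.centralBinom) ^ 2 = m.centralBinom ^ 2 * M ^ 2 := by ring
      _ ≤ m.centralBinom ^ 2 * (2 * m + 1) := by gcongr
      _ ≤ 16 ^ m := centralBinom_sq_mul_le m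
      _ = (4 ^ m) ^ 2 := by rw [← pow_mul, mul_comm, pow_mul]; norm_num
  rcases Nat.even_or_odd' N with ⟨m, rfl | rfl⟩
  · calc M * (2 * m).choose r ≤ M * m.centralBinom := by
          gcongr; exact Nat.choose_le_centralBinom r m
      _ ≤ 4 ^ m := key m (by omega)
      _ = 2 ^ (2 * m) := by rw [pow_mul]; norm_num
  · have hchoose : (2 * m + 1).choose r ≤ 2 * m.centralBinom := by
      cases r with
      | zero => have := m.centralBinom_pos; simp; omega
      | succ r =>
        rw [Nat.choose_succ_succ']
        have := Nat.choose_le_centralBinom r m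
        have := Nat.choose_le_centralBinom (r + 1) m
        omega
    calc M * (2 * m + 1).choose r ≤ M * (2 * m.centralBinom) := by gcongr
      _ = 2 * (M * m.centralBinom) := by ring
      _ ≤ 2 * 4 ^ m := by gcongr; exact key m (by omega)
      _ = 2 ^ (2 * m + 1) := by rw [pow_succ, pow_mul]; norm_num; ring

/-- Set sizes that grow fast enough for colours with `d k` values. -/
def sparseSize (d : ℕ → ℕ) (k : ℕ) : ℕ := k + 1 + (d k * 2 ^ (k + 2)) ^ 2

theorem lt_sparseSize (d : ℕ → ℕ) (k : ℕ) : k < sparseSize d k := by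
  unfold sparseSize; omega

theorem prod_pow_choose_sparseSize_le (d : ℕ → ℕ) {N : ℕ} (hN : 0 < N) :
    ∏ k ∈ Finset.range N, d k ^ N.choose (sparseSize d k) ≤ 2 ^ 2 ^ (N - 1) := by
  have hterm : ∀ k, (d k * N.choose (sparseSize d k) : ℝ) ≤ 2 ^ N / 4 * (1 / 2) ^ k := fun k => by
    -- The square in `sparseSize` is chosen for this `M`: index `k` gets at most the share
    -- `2^{-(k+2)}` of `2^N`, and the shares sum to at most one half.
    have h := mul_choose_le_two_pow (M := d k * 2 ^ (k + 2)) (r := sparseSize d k)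
      (by unfold sparseSize; omega) N
    have h' : (d k * 2 ^ (k + 2) * N.choose (sparseSize d k) : ℝ) ≤ 2 ^ N := by exact_mod_cast h
    rw [one_div, inv_pow, div_mul_eq_mul_div, ← div_eq_mul_inv, div_div, le_div_iff₀ (by positivity)]
    calc _ = (d k * 2 ^ (k + 2) * N.choose (sparseSize d k) : ℝ) := by ring
      _ ≤ _ := h'
  have hsum : ∑ k ∈ Finset.range N, d k * N.choose (sparseSize d k) ≤ 2 ^ (N - 1) := by
    have hgeom : ∑ k ∈ Finset.range N, ((1 : ℝ) / 2) ^ k ≤ 2 :=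
      (summable_geometric_two.sum_le_tsum _ fun _ _ => by positivity).trans_eq tsum_geometric_two
    have : (∑ k ∈ Finset.range N, d k * N.choose (sparseSize d k) : ℝ) ≤ 2 ^ (N - 1) := by
      calc _ ≤ ∑ k ∈ Finset.range N, (2 : ℝ) ^ N / 4 * (1 / 2) ^ k :=
            Finset.sum_le_sum fun k _ => hterm k
        _ = 2 ^ N / 4 * ∑ k ∈ Finset.range N, ((1 : ℝ) / 2) ^ k := by rw [Finset.mul_sum]
        _ ≤ 2 ^ N / 4 * 2 := by gcongr
        _ = 2 ^ (N - 1) := by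
          obtain ⟨M, rfl⟩ := Nat.exists_eq_succ_of_ne_zero hN.ne'
          simp [pow_succ]; ring
    exact_mod_cast this
  calc ∏ k ∈ Finset.range N, d k ^ N.choose (sparseSize d k)
      ≤ ∏ k ∈ Finset.range N, 2 ^ (d k * N.choose (sparseSize d k)) :=
        Finset.prod_le_prod' fun k _ => by
          rw [pow_mul]
          exact Nat.pow_le_pow_left Nat.lt_two_pow_self.le _
    _ = 2 ^ ∑ k ∈ Finset.range N, d k * N.choose (sparseSize d k) :=
        Finset.prod_pow_eq_pow_sum _ _ _
    _ ≤ _ := Nat.pow_le_pow_right two_pos hsum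

theorem isLittleO_two_pow_two_pow {f : ℕ → ℕ}
    (hf : ∀ N, 0 < N → f N ≤ (2 ^ N) ^ N * 2 ^ 2 ^ (N - 1)) :
    (fun N => (f N : ℝ)) =o[atTop] fun N : ℕ => (2 : ℝ) ^ 2 ^ N := by
  -- This absorbs the equality-pattern factor `2^{N²}` and leaves a spare factor `2^N`, which gives
  -- the little-o.
  have hquad : ∀ N : ℕ, 8 ≤ N → N * N + N ≤ 2 ^ (N - 1) := by
    intro N hN
    induction N, hN using Nat.le_induction with
    | base => norm_num
    | succ N hN ih =>
      obtain ⟨M, rfl⟩ := Nat.exists_eq_succ_of_ne_zero (show N ≠ 0 by omega)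
      simp only [Nat.succ_eq_add_one, Nat.add_sub_cancel, pow_succ] at ih ⊢
      nlinarith
  have hbound : ∀ N : ℕ, 8 ≤ N → f N * 2 ^ N ≤ 2 ^ 2 ^ N := by
    intro N hN
    calc f N * 2 ^ N ≤ ((2 ^ N) ^ N * 2 ^ 2 ^ (N - 1)) * 2 ^ N := by
          gcongr; exact hf N (by omega)
      _ = 2 ^ (N * N + N) * 2 ^ 2 ^ (N - 1) := by rw [← pow_mul, pow_add]; ring
      _ ≤ 2 ^ 2 ^ (N - 1) * 2 ^ 2 ^ (N - 1) := by
          gcongr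
          · norm_num
          · exact hquad N hN
      _ = 2 ^ 2 ^ N := by
          obtain ⟨M, rfl⟩ := Nat.exists_eq_succ_of_ne_zero (show N ≠ 0 by omega)
          simp only [Nat.succ_eq_add_one, Nat.add_sub_cancel]
          rw [← pow_add]; congr 1; ring
  have hO : (fun N => (f N : ℝ)) =O[atTop] fun N : ℕ => (1 / 2 : ℝ) ^ N * (2 : ℝ) ^ 2 ^ N := by
    refine IsBigO.of_bound 1 ?_
    filter_upwards [eventually_ge_atTop 8] with N hN
    have h : (f N * 2 ^ N : ℝ) ≤ 2 ^ 2 ^ N := by exact_mod_cast hbound N hN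
    rw [Real.norm_of_nonneg (by positivity), Real.norm_of_nonneg (by positivity), one_mul,
      one_div, inv_pow, ← div_eq_inv_mul, le_div_iff₀ (by positivity)]
    exact h
  refine hO.trans_isLittleO ?_
  have h0 : (fun N : ℕ => (1 / 2 : ℝ) ^ N) =o[atTop] fun _ => (1 : ℝ) :=
    (isLittleO_one_iff ℝ).2 (tendsto_pow_atTop_nhds_zero_of_lt_one (by norm_num) (by norm_num))
  simpa using h0.mul_isBigO (isBigO_refl (fun N : ℕ => (2 : ℝ) ^ 2 ^ N) atTop)

end Growth

/-! ## The structure of a colouring -/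

section ColourStructure

variable {B : ℕ → Type} {C C' : Type} [DecidableEq C] [DecidableEq C']

/-- The relation `Q` is invariant under all polymorphisms of `A`. -/
def IsPolInvariant (K : FirstOrder.Language.{u, v}) {A : Type w} [K.Structure A] {l : ℕ}
    (Q : Set (Fin l → A)) : Prop :=
  ∀ (m : ℕ) (f : (Fin m → A) → A), IsPolymorphism K f →
    ∀ r : Fin m → Fin l → A, (∀ i, r i ∈ Q) → (fun j => f fun i => r i j) ∈ Q

/-- Relation symbols for a colouring: disequality of two coordinates, and, for every invariant
relation `Q` of the structure of `k`-colours, the relation which says that certain blocks of `n k`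
coordinates are injective and that their colours are related by `Q`. -/
inductive ColourRel (n : ℕ → ℕ) (B : ℕ → Type) (K : ℕ → FirstOrder.Language.{0, 0})
    [∀ k, (K k).Structure (B k)] : ℕ → Type
  | ne {N : ℕ} (i j : Fin N) : ColourRel n B K N
  | colour {N : ℕ} (k : ℕ) {l : ℕ} (p : Fin l → Fin (n k) → Fin N) (Q : Set (Fin l → B k))
      (hQ : IsPolInvariant (K k) Q) : ColourRel n B K N

/-- The relational language of colourings. -/
abbrev colourLanguage (n : ℕ → ℕ) (B : ℕ → Type) (K : ℕ → FirstOrder.Language.{0, 0})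
    [∀ k, (K k).Structure (B k)] : FirstOrder.Language.{0, 0} :=
  ⟨fun _ => Empty, ColourRel n B K⟩

variable {n : ℕ → ℕ} {K : ℕ → FirstOrder.Language.{0, 0}} [∀ k, (K k).Structure (B k)]

/-- The interpretation of the relation symbols by a colouring. -/
def ColourRel.Holds (c : Colouring B C) : ∀ {N : ℕ}, ColourRel n B K N → (Fin N → C) → Prop
  | _, .ne i j, x => x i ≠ x j
  | _, .colour k p Q _, x => (∀ j, Function.Injective (x ∘ p j)) ∧
      (fun j => c k (Finset.univ.image (x ∘ p j))) ∈ Q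

/-- The relational structure of a colouring. -/
@[reducible]
def Colouring.structure (n : ℕ → ℕ) (K : ℕ → FirstOrder.Language.{0, 0})
    [∀ k, (K k).Structure (B k)] (c : Colouring B C) : (colourLanguage n B K).Structure C where
  funMap f := f.elim
  RelMap R x := ColourRel.Holds c R x

variable {c : Colouring B C} {c' : Colouring B C'}

theorem isPolInvariant_singleton {k : ℕ} (hid : PolIsIdempotent (K k) (B k)) (b : B k) :
    IsPolInvariant (K k) {x : Fin 1 → B k | x 0 = b} := by
  intro m f hf r hr
  have : (fun i => r i 0) = fun _ => b := funext hr
  simp only [Set.mem_ofPred_eq, this, hid m f hf]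

theorem isPolInvariant_eq (k : ℕ) : IsPolInvariant (K k) {x : Fin 2 → B k | x 0 = x 1} := by
  intro m f _ r hr
  exact congrArg f (funext hr)

theorem exists_embedding_of_card_eq {X : Type*} {Z : Finset X} {m : ℕ} (hZ : Z.card = m) :
    ∃ x : Fin m → X, Function.Injective x ∧ ∀ (Y : Type) [DecidableEq Y] (g : X → Y),
      Finset.univ.image (g ∘ x) = Z.image g := by
  classical
  refine ⟨fun i => (Z.equivFinOfCardEq hZ).symm i, fun i j h => ?_, fun Y _ g => ?_⟩
  · simpa [Subtype.ext_iff] using h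
  · ext y
    simp only [Finset.mem_image, Finset.mem_univ, true_and, Function.comp]
    constructor
    · rintro ⟨i, rfl⟩
      exact ⟨_, ((Z.equivFinOfCardEq hZ).symm i).2, rfl⟩
    · rintro ⟨a, ha, rfl⟩
      exact ⟨Z.equivFinOfCardEq hZ ⟨a, ha⟩, by simp⟩

/-- Preservation in one direction is enough, because disequality and each single colour are
themselves relations. Hence the lemma covers endomorphisms as well as embeddings. -/
theorem injective_and_colour_of_holds (hid : ∀ k, PolIsIdempotent (K k) (B k)) {X : Type}
    {g : X → C} {h : X → C'} (hg : Function.Injective g)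
    (hgh : ∀ (N : ℕ) (R : ColourRel n B K N) (x : Fin N → X), R.Holds c (g ∘ x) →
      R.Holds c' (h ∘ x)) :
    Function.Injective h ∧ ∀ k (Z : Finset X), Z.card = n k →
      c k (Z.image g) = c' k (Z.image h) := by
  refine ⟨fun a b hab => ?_, fun k Z hZ => ?_⟩
  · by_contra hne
    exact hgh 2 (.ne 0 1) ![a, b] (fun h => hne (hg h)) hab
  · obtain ⟨x, hx, himage⟩ := exists_embedding_of_card_eq hZ
    have := (hgh (n k) (.colour k (fun (_ : Fin 1) => id) _ (isPolInvariant_singleton (hid k) _)) x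
      ⟨fun _ => hg.comp hx, rfl⟩).2
    simp only [Function.comp_id, himage, Set.mem_ofPred_eq] at this
    exact this.symm

theorem IsStrong.holds_iff {f : C → C'} (hf : IsStrong n c c' f) {N : ℕ} (R : ColourRel n B K N)
    (x : Fin N → C) : R.Holds c' (f ∘ x) ↔ R.Holds c x := by
  cases R with
  | ne i j => exact hf.injective.ne_iff
  | colour k p Q hQ =>
    have hinj : (∀ j, Function.Injective ((f ∘ x) ∘ p j)) ↔
        ∀ j, Function.Injective (x ∘ p j) :=
      forall_congr' fun j => hf.injective.of_comp_iff (x ∘ p j)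
    refine (and_congr_left' hinj).trans (and_congr_right fun hx => ?_)
    have : ∀ j, c' k (Finset.univ.image ((f ∘ x) ∘ p j)) = c k (Finset.univ.image (x ∘ p j)) :=
      fun j => by
        rw [Function.comp_assoc, ← Finset.image_image, hf.colour k]
        rw [Finset.card_image_of_injective _ (hx j), Finset.card_univ, Fintype.card_fin]
    simp only [this]

theorem isPolInvariant_relMap (k : ℕ) {l : ℕ} (R : (K k).Relations l) :
    IsPolInvariant (K k) {x : Fin l → B k | Structure.RelMap R x} :=
  fun _ _ hf r hr => hf l R r hr

/-- Strong operations which act on colours by polymorphisms are polymorphisms. -/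
theorem IsStrong.isPolymorphism {m : ℕ} (hm : 0 < m) {c : Colouring B C}
    {F : (Fin m → C) → C} {φ : ∀ k, (Fin m → B k) → B k} (hφ : ∀ k, IsPolymorphism (K k) (φ k))
    (hF : IsStrong n (fun k X => φ k fun j => c k (X.image fun y => y j)) c F) :
    letI := c.structure n K
    IsPolymorphism (colourLanguage n B K) F := by
  intro N R r hr
  cases R with
  -- Injectivity of `F` makes the two columns equal, contradicting any one row; this is where `0 <
  -- m` is needed.
  | ne i j => exact fun h => hr ⟨0, hm⟩ (congrFun (hF.injective h) ⟨0, hm⟩)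
  | colour k p Q hQ =>
    have hinj : ∀ j, Function.Injective fun s i => r i (p j s) := fun j s s' h =>
      (hr ⟨0, hm⟩).1 j (congrFun h ⟨0, hm⟩)
    refine ⟨fun j => hF.injective.comp (hinj j), ?_⟩
    have key : ∀ j, c k (Finset.univ.image ((fun s => F fun i => r i s) ∘ p j)) =
        φ k fun i => c k (Finset.univ.image (r i ∘ p j)) := fun j => by
      have := hF.colour k (Finset.univ.image fun s i => r i (p j s)) (by
        rw [Finset.card_image_of_injective _ (hinj j), Finset.card_univ, Fintype.card_fin])
      simp only [Finset.image_image] at this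
      exact this
    simp only [key]
    exact hQ m (φ k) (hφ k) _ fun i => (hr i).2

theorem IsStrong.isPolymorphism_unary {c : Colouring B C} {f : C → C} (hf : IsStrong n c c f) :
    letI := c.structure n K
    IsPolymorphism (colourLanguage n B K) fun x : Fin 1 → C => f (x 0) :=
  fun _ R r hr => (hf.holds_iff R (r 0)).2 (hr 0)

theorem IsGeneric.exists_automorphism [Countable C] {c : Colouring B C} (hc : IsGeneric n c)
    {X : Type} [Finite X] {g h : X → C} (hg : Function.Injective g) (hh : Function.Injective h)
    (hgh : ∀ k (Z : Finset X), Z.card = n k → c k (Z.image g) = c k (Z.image h)) :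
    letI := c.structure n K
    ∃ α : C ≃[colourLanguage n B K] C, ∀ x, α (g x) = h x := by
  classical
  let := c.structure n K
  have := Fintype.ofFinite X
  have hinj : Function.Injective fun x => (g x, h x) := fun x y hxy => hg (congrArg Prod.fst hxy)
  obtain ⟨α, hα, hP⟩ := hc.exists_equiv hc (Finset.univ.image fun x => (g x, h x)) ⟨by
      simp only [Finset.coe_image, Finset.coe_univ, Set.image_univ]
      rintro _ ⟨x, rfl⟩ _ ⟨y, rfl⟩ hxy
      rw [hg hxy], by
      simp only [Finset.coe_image, Finset.coe_univ, Set.image_univ]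
      rintro _ ⟨x, rfl⟩ _ ⟨y, rfl⟩ hxy
      rw [hh hxy], fun k Q hQ hcard => by
      obtain ⟨Z, -, rfl⟩ := Finset.subset_image_iff.1 (Finset.coe_subset.1 hQ)
      rw [Finset.card_image_of_injective _ hinj] at hcard
      simpa [Finset.image_image, Function.comp_def] using hgh k Z hcard⟩
  exact ⟨{ α with
    map_fun' := fun f => f.elim
    map_rel' := fun R x => hα.holds_iff R x },
    fun x => hP _ (Finset.mem_image_of_mem _ (Finset.mem_univ x))⟩

theorem IsGeneric.isUltrahomogeneous [Countable C] {c : Colouring B C} (hc : IsGeneric n c)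
    (hid : ∀ k, PolIsIdempotent (K k) (B k)) :
    letI := c.structure n K
    (colourLanguage n B K).IsUltrahomogeneous C := by
  let := c.structure n K
  intro T hT f
  have : (colourLanguage n B K).IsRelational := fun _ => inferInstanceAs (IsEmpty Empty)
  have := hT.finite
  obtain ⟨hinj, hcol⟩ := injective_and_colour_of_holds (n := n) (K := K) (c := c) (c' := c) hid
    (g := ((↑) : T → C)) (h := f) Subtype.val_injective
    fun N R x hR => (f.map_rel R x).2 hR
  obtain ⟨α, hα⟩ := hc.exists_automorphism (K := K) Subtype.val_injective hinj hcol
  exact ⟨α, Embedding.ext fun x => (hα x).symm⟩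

theorem IsGeneric.isModelCompleteCore [Countable C] {c : Colouring B C} (hc : IsGeneric n c)
    (hid : ∀ k, PolIsIdempotent (K k) (B k)) :
    letI := c.structure n K
    IsModelCompleteCore (colourLanguage n B K) C := by
  let := c.structure n K
  intro e F
  obtain ⟨hinj, hcol⟩ := injective_and_colour_of_holds (n := n) (K := K) (c := c) (c' := c) hid
    (g := ((↑) : F → C)) (h := e ∘ ((↑) : F → C)) Subtype.val_injective
    fun N R x hR => e.map_rel R _ hR
  obtain ⟨α, hα⟩ := hc.exists_automorphism (K := K) Subtype.val_injective hinj hcol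
  exact ⟨α, fun x hx => (hα ⟨x, hx⟩).symm⟩

theorem IsGeneric.exists_injective_orbits [Countable C] {c : Colouring B C} (hc : IsGeneric n c)
    (hn : ∀ k, k < n k) (N : ℕ) :
    letI := c.structure n K
    ∃ φ : Orbits (colourLanguage n B K) C N → (Fin N → Fin N → Bool) ×
        (∀ k : Fin N, Finset.powersetCard (n k) (Finset.univ : Finset (Fin N)) → B k),
      Function.Injective φ := by
  let := c.structure n K
  refine ⟨fun o => (fun i j => decide (o.out i = o.out j), fun k Z => c k (Z.1.image o.out)),
    fun a b hab => ?_⟩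
  rw [← Quotient.out_eq a, ← Quotient.out_eq b]
  apply Quotient.sound
  have hker : ∀ i j, a.out i = a.out j ↔ b.out i = b.out j := fun i j => by
    simpa using congrFun (congrFun (congrArg Prod.fst hab) i) j
  have hcol : ∀ k (Z : Finset (Fin N)), Z.card = n k →
      c k (Z.image a.out) = c k (Z.image b.out) := fun k Z hZ => by
    -- Colours of index `k ≥ N` need not be recorded: `n k > k`, so `N` coordinates contain no set
    -- of that size.
    have hk : k < N := (hn k).trans_le (by simpa [hZ] using Z.card_le_univ)
    exact congrFun (congrFun (congrArg Prod.snd hab) ⟨k, hk⟩)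
      ⟨Z, Finset.mem_powersetCard.2 ⟨Finset.subset_univ _, hZ⟩⟩
  -- One index is picked for each value of the tuple, turning sets of values into sets of indices.
  let s : Set.range a.out → Fin N := fun x => x.2.choose
  have hs : ∀ x, a.out (s x) = x := fun x => x.2.choose_spec
  have hsinj : Function.Injective s := fun x y hxy => Subtype.ext (by rw [← hs x, ← hs y, hxy])
  obtain ⟨α, hα⟩ := hc.exists_automorphism (K := K) (g := ((↑) : Set.range a.out → C))
    (h := b.out ∘ s) Subtype.val_injective
    (fun x y hxy => Subtype.ext (by rw [← hs x, ← hs y]; exact (hker _ _).2 hxy))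
    (fun k Z hZ => by
      have := hcol k (Z.image s) (by rw [Finset.card_image_of_injective _ hsinj, hZ])
      rw [Finset.image_image, Finset.image_image] at this
      rw [← this]
      exact congrArg _ (Finset.image_congr fun x _ => (hs x).symm))
  refine ⟨α, fun i => ?_⟩
  rw [hα ⟨a.out i, i, rfl⟩]
  exact (hker _ _).1 (hs _)

theorem IsGeneric.isOmegaCategorical [Countable C] [Infinite C] [∀ k, Finite (B k)]
    {c : Colouring B C} (hc : IsGeneric n c) (hn : ∀ k, k < n k) :
    letI := c.structure n K
    IsOmegaCategorical (colourLanguage n B K) C := by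
  refine ⟨inferInstance, inferInstance, fun N => ?_⟩
  obtain ⟨φ, hφ⟩ := hc.exists_injective_orbits (K := K) hn N
  exact Finite.of_injective φ hφ

theorem IsGeneric.hasSmallOrbitGrowth [Countable C] [∀ k, Finite (B k)] {c : Colouring B C}
    (hc : IsGeneric (sparseSize fun k => Nat.card (B k)) c) :
    letI := c.structure (sparseSize fun k => Nat.card (B k)) K
    HasSmallOrbitGrowth (colourLanguage (sparseSize fun k => Nat.card (B k)) B K) C := by
  refine isLittleO_two_pow_two_pow fun N hN => ?_
  obtain ⟨φ, hφ⟩ := hc.exists_injective_orbits (K := K) (lt_sparseSize _) N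
  refine (Nat.card_le_card_of_injective φ hφ).trans ?_
  rw [Nat.card_prod]
  refine Nat.mul_le_mul (by simp)
    (le_trans (le_of_eq ?_) (prod_pow_choose_sparseSize_le (fun k => Nat.card (B k)) hN))
  rw [Nat.card_pi, ← Fin.prod_univ_eq_prod_range
    (fun k => Nat.card (B k) ^ N.choose (sparseSize (fun k => Nat.card (B k)) k))]
  refine Finset.prod_congr rfl fun k _ => ?_
  rw [Nat.card_fun]
  simp

end ColourStructure

/-! ## The action of polymorphisms on colours -/

section Action

variable {B : ℕ → Type} {C : Type} [DecidableEq C] {n : ℕ → ℕ} {K : ℕ → FirstOrder.Language.{0, 0}}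
  [∀ k, (K k).Structure (B k)] {c : Colouring B C}

theorem injective_of_isPolymorphism {m : ℕ} {F : (Fin m → C) → C}
    (hF : letI := c.structure n K; IsPolymorphism (colourLanguage n B K) F) {N : ℕ}
    (x : Fin m → Fin N → C) (hx : ∀ i, Function.Injective (x i)) :
    Function.Injective fun s => F fun i => x i s := by
  intro s s' h
  by_contra hne
  exact hF N (.ne s s') x (fun i => (hx i).ne hne) h

theorem colour_mem_of_isPolymorphism {m : ℕ} {F : (Fin m → C) → C}
    (hF : letI := c.structure n K; IsPolymorphism (colourLanguage n B K) F) {k l : ℕ}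
    {Q : Set (Fin l → B k)} (hQ : IsPolInvariant (K k) Q) (x : Fin m → Fin l → Fin (n k) → C)
    (hx : ∀ i j, Function.Injective (x i j))
    (hxQ : ∀ i, (fun j => c k (Finset.univ.image (x i j))) ∈ Q) :
    (fun j => c k (Finset.univ.image fun s => F fun i => x i j s)) ∈ Q := by
  -- The blocks are laid out on disjoint coordinates, so nothing is required between different
  -- blocks.
  obtain ⟨e⟩ : Nonempty (Fin l × Fin (n k) ≃ Fin (l * n k)) := ⟨finProdFinEquiv⟩
  have hcomp : ∀ i j, (fun s => x i (e.symm s).1 (e.symm s).2) ∘ (fun s => e (j, s)) = x i j :=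
    fun i j => by funext s; simp
  have := (hF (l * n k) (.colour k (fun j s => e (j, s)) Q hQ)
    (fun i s => x i (e.symm s).1 (e.symm s).2)
    (fun i => ⟨fun j => by rw [hcomp]; exact hx i j, by simpa only [hcomp] using hxQ i⟩)).2
  simpa [Function.comp_def] using this

/-- A symbol acts on colours by choosing an injective tuple `X b` of each colour `b`, applying the
operation coordinatewise and taking the colour of the result. This is compatible with composition,
so identities between arbitrary terms descend. -/
theorem IsGeneric.polSatisfies_of_polSatisfies [Infinite C] (hc : IsGeneric n c)
    (hn : ∀ k, k < n k) (k : ℕ) {L' : FirstOrder.Language.{u', v'}} {D : EquationalCondition L'}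
    (h : letI := c.structure n K; PolSatisfies (colourLanguage n B K) C D) :
    PolSatisfies (K k) (B k) D := by
  obtain ⟨I, hI, hD⟩ := h
  have hex : ∀ b : B k, ∃ x : Fin (n k) → C, Function.Injective x ∧
      c k (Finset.univ.image x) = b := fun b => by
    obtain ⟨Z, hZ, hb⟩ := hc.exists_card_eq hn k b
    obtain ⟨x, hx, himage⟩ := exists_embedding_of_card_eq hZ
    exact ⟨x, hx, by rw [← hb]; simpa using congrArg (c k) (himage C id)⟩
  choose X hXinj hX using hex
  let J : L'.Structure (B k) :=
    { funMap := fun f a => c k (Finset.univ.image fun s => I.funMap f fun i => X (a i) s)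
      RelMap := fun _ _ => False }
  have key : ∀ (t : L'.Term ℕ) (x : ℕ → Fin (n k) → C), (∀ v, Function.Injective (x v)) →
      (Function.Injective fun s => t.realize fun v => x v s) ∧
      c k (Finset.univ.image fun s => t.realize fun v => x v s) =
        t.realize fun v => c k (Finset.univ.image (x v)) := by
    intro t x hx
    induction t with
    | var v => exact ⟨hx v, rfl⟩
    | @func m f ts ih =>
      refine ⟨injective_of_isPolymorphism (hI m f) (fun i s => (ts i).realize fun v => x v s)
        fun i => (ih i).1, ?_⟩
      -- Invariance of equality shows that the resulting colour depends only on the colours of the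
      -- arguments, so actual subterm values may be replaced by the chosen tuples.
      exact colour_mem_of_isPolymorphism (hI m f) (isPolInvariant_eq k)
        (fun i => ![fun s => (ts i).realize fun v => x v s,
          X ((ts i).realize fun v => c k (Finset.univ.image (x v)))])
        (fun i j => by
          fin_cases j
          · exact (ih i).1
          · exact hXinj _)
        fun i => ((ih i).2.trans (hX _).symm :)
  refine ⟨J, fun m f l R r hr => ?_, fun e he y => ?_⟩
  · exact colour_mem_of_isPolymorphism (hI m f) (isPolInvariant_relMap k R)
      (fun i j => X (r i j)) (fun i j => hXinj _) fun i => by simpa only [hX, Set.mem_ofPred_eq] using hr i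
  · have h₁ := (key e.1 (fun v => X (y v)) fun v => hXinj _).2
    have h₂ := (key e.2 (fun v => X (y v)) fun v => hXinj _).2
    simp only [hX] at h₁ h₂
    rw [← h₁, ← h₂]
    simp only [hD e he]

end Action

/-! ## Interpretation of minor terms in a generic colouring -/

section Interpretation

variable {LS : FirstOrder.Language.{u, v}} {B : ℕ → Type} [∀ k, LS.Structure (B k)]
  {C : Type} [DecidableEq C] {n : ℕ → ℕ} {c : Colouring B C}

/-- The operations of `J` are strong for the colourings of the powers of `C` in which the colour of a
set is computed from the colours of its projections. -/
def IsColourCompatible (n : ℕ → ℕ) (c : Colouring B C) (J : LS.Structure C) : Prop :=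
  ∀ (m : ℕ) (f : LS.Functions m),
    IsStrong n (fun k X => Structure.funMap f fun j => c k (X.image fun y => y j)) c (J.funMap f)

theorem IsGeneric.exists_isColourCompatible [Countable C] (hn : ∀ k, k < n k)
    (hc : IsGeneric n c) : ∃ J : LS.Structure C, IsColourCompatible n c J := by
  choose F hF using fun (m : ℕ) (f : LS.Functions m) => hc.exists_isStrong hn
    fun k (X : Finset (Fin m → C)) => Structure.funMap f fun j => c k (X.image fun y => y j)
  exact ⟨⟨fun {m} f => F m f, fun _ _ => False⟩, hF⟩

variable [J : LS.Structure C] {V : Finset ℕ}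

theorem IsMinorTerm.realize_congr {A : Type*} [LS.Structure A] {t : LS.Term ℕ} (ht : IsMinorTerm t)
    {x y : ℕ → A} (h : ∀ v ∈ t.varFinset, x v = y v) : t.realize x = t.realize y := by
  obtain ⟨m, f, σ, rfl⟩ := ht
  have : ∀ i, x (σ i) = y (σ i) := fun i => h _ (by simp [Term.varFinset])
  simp [this]

/-- Extension of a partial assignment of values to variables. -/
def extendAssignment [Inhabited C] (V : Finset ℕ) (y : V → C) (v : ℕ) : C :=
  if h : v ∈ V then y ⟨v, h⟩ else default

/-- The operation is injective and every variable of `V` occurs among its arguments. Balance is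
needed so that both sides of an identity have the same `V`. -/
theorem IsMinorTerm.injective_realize [Inhabited C] {t : LS.Term ℕ} (ht : IsMinorTerm t)
    (hJ : IsColourCompatible n c J) (hV : t.varFinset = V) :
    Function.Injective fun y : V → C => t.realize (extendAssignment V y) := by
  obtain ⟨m, f, σ, rfl⟩ := ht
  intro y z hyz
  have h := (hJ m f).injective hyz
  funext ⟨v, hv⟩
  obtain ⟨i, rfl⟩ : ∃ i, σ i = v := by simpa [← hV, Term.varFinset, eq_comm] using hv
  simpa [extendAssignment, hv] using congrFun h i

theorem IsMinorTerm.colour_realize [Inhabited C] {t : LS.Term ℕ} (ht : IsMinorTerm t)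
    (hJ : IsColourCompatible n c J) (hV : t.varFinset = V)
    {k : ℕ} {X : Finset (V → C)} (hX : X.card = n k) :
    c k (X.image fun y => t.realize (extendAssignment V y)) =
      t.realize fun v => c k (X.image fun y => extendAssignment V y v) := by
  have hinj := ht.injective_realize hJ hV
  obtain ⟨m, f, σ, rfl⟩ := ht
  have hinj' : Function.Injective fun (y : V → C) (i : Fin m) => extendAssignment V y (σ i) :=
    fun y z h => hinj (congrArg (Structure.funMap f) h)
  have := (hJ m f).colour k (X.image fun y i => extendAssignment V y (σ i))
    (by rw [Finset.card_image_of_injective _ hinj', hX])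
  simp only [Finset.image_image] at this
  exact this

/-- Countably many minor terms with the same variables which agree on all colours can be equalized
by strong maps. -/
theorem IsGeneric.exists_equalizing_terms [Inhabited C] [Countable C] (hn : ∀ k, k < n k)
    (hc : IsGeneric n c) (hJ : IsColourCompatible n c J)
    {ι : Type*} [Countable ι] (t : ι → LS.Term ℕ) (ht : ∀ i, IsMinorTerm (t i))
    (hV : ∀ i, (t i).varFinset = V)
    (heq : ∀ i j k (x : ℕ → B k), (t i).realize x = (t j).realize x) :
    ∃ u : ι → C → C, (∀ i, IsStrong n c c (u i)) ∧
      ∀ i j (x : ℕ → C), u i ((t i).realize x) = u j ((t j).realize x) := by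
  obtain ⟨u, hu, h⟩ := hc.exists_equalizing hn
    (fun i (y : V → C) => (t i).realize (extendAssignment V y))
    (fun i => (ht i).injective_realize hJ (hV i))
    (fun i j k X hX => by
      rw [(ht i).colour_realize hJ (hV i) hX, (ht j).colour_realize hJ (hV j) hX, heq i j])
  refine ⟨u, hu, fun i j x => ?_⟩
  have hx : ∀ i, (t i).realize x = (t i).realize (extendAssignment V fun v => x v) := fun i =>
    (ht i).realize_congr fun v hv => by simp [extendAssignment, ← hV i, hv]
  rw [hx, hx]
  exact h i j _

end Interpretation

/-! ## Pseudo-versions -/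

section Pseudo

variable {LS : FirstOrder.Language.{u, v}} {L : FirstOrder.Language.{u', v'}} {A : Type w}
  [L.Structure A]

theorem realize_pseudoTerm [LS.Structure A] {U : Type*} [(unaryLanguage U).Structure A] (x : U)
    (t : LS.Term ℕ) (y : ℕ → A) : (pseudoTerm x t).realize y =
      Structure.funMap (L := unaryLanguage U) (n := 1) (UnarySymbols.symb x)
        fun _ => t.realize y :=
  congrArg (fun a => Structure.funMap (L := unaryLanguage U) (n := 1) (UnarySymbols.symb x)
    fun _ => a) ((LHom.sumInl : LS →ᴸ LS.sum (unaryLanguage U)).realize_onTerm t y)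

/-- The structure in which the unary symbols are interpreted by `p`. -/
@[reducible]
def unaryStructure {U : Type*} (p : U → A → A) : (unaryLanguage U).Structure A where
  funMap f := match f with
    | .symb x => fun y => p x (y 0)
  RelMap R := R.elim

theorem polSatisfies_of_unary {U : Type*} (J : LS.Structure A)
    (hJ : ∀ m (f : LS.Functions m), IsPolymorphism L (J.funMap f)) (p : U → A → A)
    (hp : ∀ x, IsPolymorphism L fun y : Fin 1 → A => p x (y 0))
    {S : EquationalCondition (LS.sum (unaryLanguage U))}
    (hS : ∀ e ∈ S, ∃ x s y t, e = (pseudoTerm x s, pseudoTerm y t) ∧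
      ∀ z : ℕ → A, p x (s.realize z) = p y (t.realize z)) : PolSatisfies L A S := by
  let := unaryStructure p
  refine ⟨inferInstance, ?_, ?_⟩
  · rintro m (f | f)
    · exact hJ m f
    · change UnarySymbols U m at f
      cases f with
      | symb x => exact hp x
  · intro e he z
    obtain ⟨x, s, y, t, rfl, h⟩ := hS e he
    simp only [realize_pseudoTerm]
    exact h z

end Pseudo

/-! ### The pseudo-versions hold, and the theorem -/

section Main

/-- An idempotent constant forces a one-element domain, where every identity holds. Separation thus
excludes nullary symbols, whose lifts need not be polymorphisms. -/
theorem polSatisfies_of_nullary {K : FirstOrder.Language.{u, v}} {A : Type w} [K.Structure A]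
    (hid : PolIsIdempotent K A) {f : (Fin 0 → A) → A} (hf : IsPolymorphism K f)
    {L' : FirstOrder.Language.{u', v'}} (D : EquationalCondition L') : PolSatisfies K A D := by
  have : Subsingleton A := ⟨fun a b => by
    rw [← hid 0 f hf a, ← hid 0 f hf b]
    exact congrArg f (Subsingleton.elim _ _)⟩
  refine ⟨⟨fun _ _ => f Fin.elim0, fun _ _ => False⟩, fun m _ n R r _ => ?_,
    fun e _ x => Subsingleton.elim _ _⟩
  convert hf n R Fin.elim0 fun i => i.elim0

variable {LS : FirstOrder.Language.{u, v}} {B : ℕ → Type} [∀ k, LS.Structure (B k)]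
  {K : ℕ → FirstOrder.Language.{0, 0}} [∀ k, (K k).Structure (B k)]
  {C : Type} [DecidableEq C] [Inhabited C] [Countable C] {n : ℕ → ℕ} {c : Colouring B C}
  {S : EquationalCondition LS} [J : LS.Structure C]

theorem IsGeneric.polSatisfies_pseudo (hn : ∀ k, k < n k) (hc : IsGeneric n c)
    (hJ : IsColourCompatible n c J)
    (hJpol : letI := c.structure n K;
      ∀ m (f : LS.Functions m), IsPolymorphism (colourLanguage n B K) (J.funMap f))
    (hminor : S.IsMinor) (hbalanced : S.IsBalanced)
    (hS : ∀ k, ∀ e ∈ S, ∀ x : ℕ → B k, e.1.realize x = e.2.realize x) :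
    letI := c.structure n K
    PolSatisfies (colourLanguage n B K) C S.pseudo := by
  have hex : ∀ e : S, ∃ u : Bool → C → C, (∀ i, IsStrong n c c (u i)) ∧
      ∀ x : ℕ → C, u false (e.1.1.realize x) = u true (e.1.2.realize x) := fun e => by
    obtain ⟨u, hu, h⟩ := hc.exists_equalizing_terms hn hJ (V := e.1.1.varFinset)
      (fun i : Bool => bif i then e.1.2 else e.1.1)
      (by rintro (_ | _); exacts [(hminor e.1 e.2).1, (hminor e.1 e.2).2])
      (by rintro (_ | _); exacts [rfl, (hbalanced e.1 e.2).symm])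
      (by
        rintro (_ | _) (_ | _) k x
        exacts [rfl, hS k e.1 e.2 x, (hS k e.1 e.2 x).symm, rfl])
    exact ⟨u, hu, h false true⟩
  choose u hu h using hex
  let := c.structure n K
  refine polSatisfies_of_unary J hJpol (fun x : S × Bool => u x.1 x.2)
    (fun x => (hu x.1 x.2).isPolymorphism_unary) ?_
  rintro _ ⟨e, rfl⟩
  exact ⟨_, _, _, _, rfl, h e⟩

theorem IsGeneric.polSatisfies_termPseudo (hn : ∀ k, k < n k) (hc : IsGeneric n c)
    (hJ : IsColourCompatible n c J)
    (hJpol : letI := c.structure n K;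
      ∀ m (f : LS.Functions m), IsPolymorphism (colourLanguage n B K) (J.funMap f))
    (hminor : S.IsMinor) (hbalanced : S.IsBalanced)
    (hS : ∀ k, ∀ e ∈ S, ∀ x : ℕ → B k, e.1.realize x = e.2.realize x) (hcount : S.Countable) :
    letI := c.structure n K
    PolSatisfies (colourLanguage n B K) C S.termPseudo := by
  let T : Set (LS.Term ℕ) := Prod.fst '' S ∪ Prod.snd '' S
  have hT : Countable T := ((hcount.image _).union (hcount.image _)).to_subtype
  have hTminor : ∀ t ∈ T, IsMinorTerm t := by
    rintro _ (⟨e, he, rfl⟩ | ⟨e, he, rfl⟩)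
    exacts [(hminor e he).1, (hminor e he).2]
  -- Terms linked by a chain of identities form one class. They share their variables and their
  -- values in every `B k`, so a whole class is equalized at once.
  let r : LS.Term ℕ → LS.Term ℕ → Prop := fun s t => (s, t) ∈ S
  have hex : ∀ q : Quot r, ∃ u : {t : T // Quot.mk r t = q} → C → C,
      (∀ i, IsStrong n c c (u i)) ∧
        ∀ i j (x : ℕ → C), u i (i.1.1.realize x) = u j (j.1.1.realize x) := fun q =>
    hc.exists_equalizing_terms hn hJ
      (V := Quot.lift Term.varFinset (fun s t hst => hbalanced (s, t) hst) q)
      (fun i : {t : T // Quot.mk r t = q} => i.1.1) (fun i => hTminor _ i.1.2)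
      (by rintro ⟨t, rfl⟩; rfl)
      (fun i j k x => congrArg (Quot.lift (fun t : LS.Term ℕ => t.realize x)
        fun s t hst => hS k (s, t) hst x) (i.2.trans j.2.symm))
  choose u hu h using hex
  classical
  let := c.structure n K
  refine polSatisfies_of_unary J hJpol
    (fun t => if ht : t ∈ T then u (Quot.mk r t) ⟨⟨t, ht⟩, rfl⟩ else id) (fun t => ?_) ?_
  · by_cases ht : t ∈ T
    · simpa only [dif_pos ht] using (hu _ _).isPolymorphism_unary
    · simp only [dif_neg ht]
      exact fun _ R r hr => hr 0
  · rintro _ ⟨e, he, rfl⟩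
    refine ⟨_, _, _, _, rfl, fun z => ?_⟩
    have h₁ : e.1 ∈ T := Or.inl ⟨e, he, rfl⟩
    have h₂ : e.2 ∈ T := Or.inr ⟨e, he, rfl⟩
    simp only [dif_pos h₁, dif_pos h₂]
    -- The maps depend on the class, so the two equal classes are generalized before they are
    -- identified.
    have hq : ∀ (q q' : Quot r) (hq : q = q') (hq₁ : Quot.mk r e.1 = q) (hq₂ : Quot.mk r e.2 = q'),
        u q ⟨⟨e.1, h₁⟩, hq₁⟩ (e.1.realize z) = u q' ⟨⟨e.2, h₂⟩, hq₂⟩ (e.2.realize z) := by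
      rintro q _ rfl hq₁ hq₂
      exact h q ⟨⟨e.1, h₁⟩, hq₁⟩ ⟨⟨e.2, h₂⟩, hq₂⟩ z
    exact hq _ _ (Quot.sound he) rfl rfl

end Main

theorem mainTheorem5 {LS : FirstOrder.Language.{u, v}} (S : EquationalCondition LS)
    (hminor : S.IsMinor) (hbalanced : S.IsBalanced)
    {LD : ℕ → FirstOrder.Language.{u', v'}} (D : ∀ i, EquationalCondition (LD i))
    (hsep : ∀ i, ExistsFiniteIdempotentSeparation S (D i)) :
    ∃ (L : FirstOrder.Language.{0, 0}) (A : Type) (_ : L.Structure A),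
      L.IsRelational ∧ IsOmegaCategorical L A ∧ L.IsUltrahomogeneous A ∧
      IsModelCompleteCore L A ∧ HasSmallOrbitGrowth L A ∧
      PolSatisfies L A S.pseudo ∧
      (S.Countable → PolSatisfies L A S.termPseudo) ∧
      ∀ i, ¬ PolSatisfies L A (D i) := by
  choose K B inst _ hfin hne hid hsat hnsat using hsep
  choose I hI hIS using hsat
  let n := sparseSize fun k => Nat.card (B k)
  have hn : ∀ k, k < n k := lt_sparseSize _
  obtain ⟨c, hc⟩ := exists_isGeneric (B := B) hn
  obtain ⟨J, hJ⟩ := hc.exists_isColourCompatible (LS := LS) hn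
  have hpos : ∀ m, LS.Functions m → 0 < m := by
    rintro (_ | m) f
    · exact absurd (polSatisfies_of_nullary (hid 0) (hI 0 0 f) (D 0)) (hnsat 0)
    · exact m.succ_pos
  have hJpol := fun m (f : LS.Functions m) =>
    (hJ m f).isPolymorphism (K := K) (hpos m f) fun k => hI k m f
  exact ⟨colourLanguage n B K, ℕ, c.structure n K, fun _ => inferInstanceAs (IsEmpty Empty),
    hc.isOmegaCategorical hn, hc.isUltrahomogeneous hid, hc.isModelCompleteCore hid,
    hc.hasSmallOrbitGrowth,
    hc.polSatisfies_pseudo hn hJ hJpol hminor hbalanced hIS,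
    hc.polSatisfies_termPseudo hn hJ hJpol hminor hbalanced hIS,
    fun i h => hnsat i (hc.polSatisfies_of_polSatisfies hn i h)⟩
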